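/- Let $\gamma>0$ and let $x_0,y_0\in\mathbb R$ with $x_0+y_0=\lambda$. Consider the continuous-time random walk $(X(t),Y(t))_{t\ge 0}$ in $\mathbb R^2$ with $(X(0),Y(0))=(x_0,y_0)$ and navigation matrix $$A=\begin{pmatrix}-\gamma&\gamma\\ \gamma&-\gamma\end{pmatrix},$$ defined as follows: from a current position $(x,y)$, given the past, the waiting time until the next renewal is exponential with rate $x+y$; independently of it, the renewal is of type 1 with probability $x/(x+y)$ and of type 2 with probability $y/(x+y)$; a renewal of type $i$ adds the $i$-th row of $A$ to the position, and between renewals the walk rests. The walk is called tenable if, whatever stochastic path is followed (that is, along every sequence of renewals whose types have positive rate $x$, respectively $y$, when they occur), it never visits the origin and both coordinates stay nonnegative. The walk is tenable if and only if $x_0/\gamma$ and $y_0/\gamma$ are nonnegative integers and $\lambda>0$. If it is tenable, then $\lambda/\gamma$ is a positive integer, almost surely $X(t)+Y(t)=\lambda$ for all $t\ge 0$, and: 1. For all $t\ge 0$ and $u\in\mathbb R$ the moment generating function $\eta(t,u)=\mathbb E[e^{uX(t)}]$ is finite and $$\eta(t,u)=\Bigl(\frac{1+e^{-2\gamma t+\gamma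 u}+e^{\gamma u}-e^{-2\gamma t}}{1-e^{-2\gamma t+\gamma u}+e^{\gamma u}+e^{-2\gamma t}}\Bigr)^{x_0/\gamma}\Bigl(\frac{1-e^{-2\gamma t+\gamma u}+e^{\gamma u}+e^{-2\gamma t}}{2}\Bigr)^{\lambda/\gamma}.$$ 2. For all $u\in\mathbb R$, $\lim_{t\to\infty}\eta(t,u)=\bigl(\frac{1+e^{\gamma u}}{2}\bigr)^{\lambda/\gamma}$. 3. As $t\to\infty$, $X(t)/\gamma$ converges in distribution to $\mathrm{Binomial}(\lambda/\gamma,1/2)$; given $\gamma$ and $\lambda$, this limit does not depend on the starting point. -/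

import Mathlib

open MeasureTheory ProbabilityTheory Filter Topology
open scoped NNReal

/-- Positions which the walk with navigation matrix `A` started at `x₀` can visit: from a
position `x`, a renewal of type `i` has positive rate iff `0 < x i`, and it adds row `i` of `A`. -/
inductive PolyaReachable {c : ℕ} (A : Matrix (Fin c) (Fin c) ℝ) (x₀ : Fin c → ℝ) :
    (Fin c → ℝ) → Prop
  | start : PolyaReachable A x₀ x₀
  | step {x : Fin c → ℝ} (i : Fin c) (hx : PolyaReachable A x₀ x) (hi : 0 < x i) :
      PolyaReachable A x₀ (x + A i)

/-- The walk is tenable: whatever stochastic path is followed, it avoids the origin and its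
coordinates stay nonnegative. -/
def PolyaTenable {c : ℕ} (A : Matrix (Fin c) (Fin c) ℝ) (x₀ : Fin c → ℝ) : Prop :=
  ∀ x, PolyaReachable A x₀ x → x ≠ 0 ∧ ∀ j, 0 ≤ x j

/-- The position after `n` renewals, when the `k`-th renewal (counted from `0`) has type `I k`. -/
def polyaPosition {Ω : Type*} {c : ℕ} (A : Matrix (Fin c) (Fin c) ℝ) (x₀ : Fin c → ℝ)
    (I : ℕ → Ω → Fin c) : ℕ → Ω → Fin c → ℝ
  | 0, _ => x₀
  | n + 1, ω => polyaPosition A x₀ I n ω + A (I n ω)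

/-- The time of the `n`-th renewal, when `T k` is the waiting time between the `k`-th and the
`(k+1)`-st renewal; `polyaRenewalTime T 0 = 0`. -/
noncomputable def polyaRenewalTime {Ω : Type*} (T : ℕ → Ω → ℝ) (n : ℕ) (ω : Ω) : ℝ :=
  ∑ k ∈ Finset.range n, T k ω

/-- The information on the first `n` renewals: the sigma-algebra generated by their waiting times
and their types. -/
@[reducible] def polyaHistory {Ω : Type*} {c : ℕ} (T : ℕ → Ω → ℝ) (I : ℕ → Ω → Fin c) (n : ℕ) :
    MeasurableSpace Ω :=
  MeasurableSpace.comap (fun ω (k : Fin n) => (T k ω, I k ω)) inferInstance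

/-- Waiting times `T` and renewal types `I` follow the dynamics of the continuum Pólya-like walk:
given the first `n` renewals, with current position `Z`, the next waiting time is exponential with
rate `∑ j, Z j`, and independently of it the type of the next renewal is `i` with probability
`Z i / ∑ j, Z j`. -/
structure IsPolyaClock {Ω : Type*} {mΩ : MeasurableSpace Ω} {c : ℕ}
    (A : Matrix (Fin c) (Fin c) ℝ) (x₀ : Fin c → ℝ) (P : Measure Ω)
    (T : ℕ → Ω → ℝ) (I : ℕ → Ω → Fin c) : Prop where
  measurable_time : ∀ n, Measurable (T n)
  measurable_type : ∀ n, Measurable (I n)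
  cond_law : ∀ (n : ℕ) (i : Fin c) (s : ℝ), 0 ≤ s →
    P⟦{ω | s < T n ω ∧ I n ω = i} | polyaHistory T I n⟧ =ᵐ[P] fun ω =>
      Real.exp (-(s * ∑ j, polyaPosition A x₀ I n ω j)) *
        (polyaPosition A x₀ I n ω i / ∑ j, polyaPosition A x₀ I n ω j)

/-- `X` is a continuum Pólya-like random walk with (deterministic) navigation matrix `A` and
starting point `x₀`: almost surely, between two consecutive renewals it rests at the position
which the renewals so far have produced. -/
def IsPolyaWalk {Ω : Type*} {mΩ : MeasurableSpace Ω} {c : ℕ}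
    (A : Matrix (Fin c) (Fin c) ℝ) (x₀ : Fin c → ℝ) (P : Measure Ω)
    (X : ℝ≥0 → Ω → Fin c → ℝ) : Prop :=
  ∃ (T : ℕ → Ω → ℝ) (I : ℕ → Ω → Fin c), IsPolyaClock A x₀ P T I ∧
    ∀ᵐ ω ∂P, ∀ (n : ℕ) (t : ℝ≥0),
      polyaRenewalTime T n ω ≤ t → (t : ℝ) < polyaRenewalTime T (n + 1) ω →
        X t ω = polyaPosition A x₀ I n ω

/-- The Ehrenfest navigation matrix. -/
def ehrenfestMatrix (γ : ℝ) : Matrix (Fin 2) (Fin 2) ℝ := !![-γ, γ; γ, -γ]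

/-! Renewals do not accumulate: the total rate `Λ = ∑ j, x j` never changes, so the `n`-th renewal
time `τ` has `E[exp (-τ)] = (Λ / (Λ + 1)) ^ n → 0`. If `u` solves Kolmogorov's backward equation of
the walk, then along the renewals `u (t - τ) (X τ)`, stopped at `t`, is a martingale, since
conditioning on the first renewal turns the backward equation into the renewal equation of `u`.
Letting the number of renewals tend to infinity gives `E[u 0 (X t)] = u t x₀`.

The Ehrenfest walk at `(γ * a, γ * b)` stands for `a + b` particles in two urns, and its backward
equation is solved by `α r ^ a * β r ^ b` whenever `α' = γ * (β - α)` and `β' = γ * (α - β)`, as if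
the particles switched urns independently at rate `γ`. With `α 0 = exp (γ * v)` and `β 0 = 1` this
is the moment generating function at a complex `v`; as `α` and `β` tend to `(1 + exp (γ * v)) / 2`,
real `v` give the limit of the moment generating function and imaginary `v` the convergence of the
characteristic functions to that of a binomial law.
-/

section Reachable

variable {c : ℕ} {A : Matrix (Fin c) (Fin c) ℝ} {x₀ x : Fin c → ℝ}

lemma PolyaReachable.sum_eq (hA : ∀ i, ∑ j, A i j = 0) (hx : PolyaReachable A x₀ x) :
    ∑ j, x j = ∑ j, x₀ j := by
  induction hx with
  | start => rfl
  | step i _ _ ih => simp only [Pi.add_apply, Finset.sum_add_distrib, ih, hA, add_zero]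

lemma PolyaReachable.add_nsmul {i : Fin c} (n : ℕ) (h : ∀ j < n, 0 < x i + j * A i i) :
    PolyaReachable A x (x + n • A i) := by
  induction n with
  | zero => simpa using PolyaReachable.start
  | succ n ih =>
    rw [succ_nsmul, ← add_assoc]
    exact .step i (ih fun j hj => h j (by omega)) (by simpa using h n n.lt_succ_self)

lemma PolyaTenable.sum_pos (hten : PolyaTenable A x₀) (hx : PolyaReachable A x₀ x) :
    0 < ∑ j, x j := by
  obtain ⟨hne, hnonneg⟩ := hten x hx
  obtain ⟨j, hj⟩ := Function.ne_iff.mp hne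
  exact Finset.sum_pos' (fun j _ => hnonneg j)
    ⟨j, Finset.mem_univ j, (hnonneg j).lt_of_ne (Ne.symm hj)⟩

end Reachable

section History

variable {Ω : Type*} {c : ℕ} {T : ℕ → Ω → ℝ} {I : ℕ → Ω → Fin c} {n : ℕ}

lemma polyaRenewalTime_succ (n : ℕ) (ω : Ω) :
    polyaRenewalTime T (n + 1) ω = polyaRenewalTime T n ω + T n ω :=
  Finset.sum_range_succ _ _

lemma measurable_time_polyaHistory {k : ℕ} (hk : k < n) : Measurable[polyaHistory T I n] (T k) :=
  (measurable_fst.comp (measurable_pi_apply (X := fun _ : Fin n => ℝ × Fin c) ⟨k, hk⟩)).comp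
    (comap_measurable fun ω (k : Fin n) => (T k ω, I k ω))

lemma measurable_type_polyaHistory {k : ℕ} (hk : k < n) : Measurable[polyaHistory T I n] (I k) :=
  (measurable_snd.comp (measurable_pi_apply (X := fun _ : Fin n => ℝ × Fin c) ⟨k, hk⟩)).comp
    (comap_measurable fun ω (k : Fin n) => (T k ω, I k ω))

lemma measurable_polyaRenewalTime_polyaHistory (T : ℕ → Ω → ℝ) (I : ℕ → Ω → Fin c) (n : ℕ) :
    Measurable[polyaHistory T I n] (polyaRenewalTime T n) :=
  Finset.measurable_fun_sum _ fun _ hk => measurable_time_polyaHistory (Finset.mem_range.mp hk)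

lemma measurable_polyaPosition {A : Matrix (Fin c) (Fin c) ℝ} {x₀ : Fin c → ℝ}
    {m : MeasurableSpace Ω} (h : ∀ k < n, Measurable[m] (I k)) :
    Measurable[m] (polyaPosition A x₀ I n) := by
  induction n with
  | zero => exact measurable_const
  | succ n ih =>
    exact (ih fun k hk => h k (hk.trans n.lt_succ_self)).add
      ((measurable_of_finite A).comp (h n n.lt_succ_self))

lemma measurable_polyaPosition_polyaHistory {A : Matrix (Fin c) (Fin c) ℝ} {x₀ : Fin c → ℝ} :
    Measurable[polyaHistory T I n] (polyaPosition A x₀ I n) :=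
  measurable_polyaPosition fun _ hk => measurable_type_polyaHistory hk

end History

lemma expMeasure_Ioi {r : ℝ} (hr : 0 < r) (s : ℝ) :
    expMeasure r (Set.Ioi s) = ENNReal.ofReal (Real.exp (-(max s 0 * r))) := by
  have := isProbabilityMeasure_expMeasure hr
  rw [← ofReal_measureReal, ← Set.compl_Iic, probReal_compl_eq_one_sub measurableSet_Iic,
    ← cdf_eq_real, cdf_expMeasure_eq hr]
  congr 1
  split_ifs with hs
  · rw [max_eq_left hs]; ring_nf
  · simp [max_eq_right (not_le.mp hs).le]

lemma integral_expMeasure {E : Type*} [NormedAddCommGroup E] [NormedSpace ℝ E] {r : ℝ}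
    (hr : 0 < r) (f : ℝ → E) :
    ∫ s, f s ∂(expMeasure r) = ∫ s in Set.Ioi 0, (r * Real.exp (-(r * s))) • f s := by
  have hm : Measurable fun s => (exponentialPDFReal r s).toNNReal := by fun_prop
  change ∫ s, f s ∂(volume.withDensity fun s => ((exponentialPDFReal r s).toNNReal : ENNReal)) = _
  rw [integral_withDensity_eq_integral_smul hm, ← integral_Ici_eq_integral_Ioi,
    ← integral_indicator measurableSet_Ici]
  congr with s
  rw [NNReal.smul_def, Real.coe_toNNReal _ (exponentialPDFReal_nonneg hr s), Set.indicator_apply]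
  simp only [exponentialPDFReal, gammaPDFReal, Set.mem_Ici]
  split_ifs <;> simp

lemma integral_exp_neg_expMeasure {r : ℝ} (hr : 0 < r) :
    ∫ s, Real.exp (-s) ∂(expMeasure r) = r / (r + 1) := by
  have hexp (s : ℝ) : (r * Real.exp (-(r * s))) • Real.exp (-s) = r * Real.exp (-(r + 1) * s) := by
    rw [smul_eq_mul, mul_assoc, ← Real.exp_add]; ring_nf
  simp only [integral_expMeasure hr, hexp, integral_const_mul]
  rw [integral_exp_mul_Ioi (by linarith), mul_zero, Real.exp_zero, neg_div_neg_eq, mul_one_div]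

namespace IsPolyaClock

variable {Ω : Type*} {mΩ : MeasurableSpace Ω} {c : ℕ} {A : Matrix (Fin c) (Fin c) ℝ}
  {x₀ : Fin c → ℝ} {P : Measure Ω} {T : ℕ → Ω → ℝ} {I : ℕ → Ω → Fin c}

lemma polyaHistory_le (h : IsPolyaClock A x₀ P T I) (n : ℕ) : polyaHistory T I n ≤ mΩ :=
  (measurable_pi_lambda _ fun k : Fin n =>
    (h.measurable_time k).prodMk (h.measurable_type k)).comap_le

lemma measurable_polyaRenewalTime (h : IsPolyaClock A x₀ P T I) (n : ℕ) :
    Measurable (polyaRenewalTime T n) :=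
  (measurable_polyaRenewalTime_polyaHistory T I n).mono (h.polyaHistory_le n) le_rfl

lemma measurableSet_polyaRenewalTime_le (h : IsPolyaClock A x₀ P T I) (n : ℕ) (t : ℝ) :
    MeasurableSet {ω | polyaRenewalTime T n ω ≤ t} :=
  measurableSet_le (h.measurable_polyaRenewalTime n) measurable_const

lemma measurableSet_lt_time_and_type_eq (h : IsPolyaClock A x₀ P T I) (n : ℕ) (i : Fin c) (s : ℝ) :
    MeasurableSet {ω | s < T n ω ∧ I n ω = i} :=
  (measurableSet_lt measurable_const (h.measurable_time n)).inter
    (h.measurable_type n (measurableSet_singleton i))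

variable [IsProbabilityMeasure P]

lemma measureReal_inter_lt_time_and_type_eq (h : IsPolyaClock A x₀ P T I) {n : ℕ} {s : ℝ}
    (hs : 0 ≤ s) (i : Fin c) {B : Set Ω} (hB : MeasurableSet[polyaHistory T I n] B) :
    P.real (B ∩ {ω | s < T n ω ∧ I n ω = i}) =
      ∫ ω in B, Real.exp (-(s * ∑ j, polyaPosition A x₀ I n ω j)) *
        (polyaPosition A x₀ I n ω i / ∑ j, polyaPosition A x₀ I n ω j) ∂P := by
  have hE := h.measurableSet_lt_time_and_type_eq n i s
  have hle := h.polyaHistory_le n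
  rw [← setIntegral_congr_ae (hle _ hB) ((h.cond_law n i s hs).mono fun ω hω _ => hω),
    setIntegral_condExp hle ((integrable_const _).indicator hE) hB, setIntegral_indicator hE,
    setIntegral_const, smul_eq_mul, mul_one]

lemma ae_time_pos_of_sum_ne_zero (h : IsPolyaClock A x₀ P T I) {n : ℕ}
    (hsum : ∀ᵐ ω ∂P, ∑ j, polyaPosition A x₀ I n ω j ≠ 0) : ∀ᵐ ω ∂P, 0 < T n ω := by
  have hm : MeasurableSet {ω | 0 < T n ω} := measurableSet_lt measurable_const (h.measurable_time n)
  have hcond (i : Fin c) := h.cond_law n i 0 le_rfl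
  simp only [zero_mul, neg_zero, Real.exp_zero, one_mul] at hcond
  have hdisj : Pairwise (Function.onFun Disjoint fun i => {ω | 0 < T n ω ∧ I n ω = i}) :=
    fun i j hij => Set.disjoint_left.mpr fun ω hi hj => hij (hi.2.symm.trans hj.2)
  have hprob : P.real {ω | 0 < T n ω} = 1 := calc
    P.real {ω | 0 < T n ω} = P.real (⋃ i, {ω | 0 < T n ω ∧ I n ω = i}) := by
      congr 1; ext ω; simp
    _ = ∑ i, P.real {ω | 0 < T n ω ∧ I n ω = i} :=
      measureReal_iUnion_fintype hdisj fun i => h.measurableSet_lt_time_and_type_eq n i 0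
    _ = ∑ i, ∫ ω, polyaPosition A x₀ I n ω i / ∑ j, polyaPosition A x₀ I n ω j ∂P := by
      refine Finset.sum_congr rfl fun i _ => ?_
      simpa using h.measureReal_inter_lt_time_and_type_eq le_rfl i MeasurableSet.univ
    _ = ∫ ω, ∑ i, polyaPosition A x₀ I n ω i / ∑ j, polyaPosition A x₀ I n ω j ∂P :=
      (integral_finsetSum _ fun i _ => integrable_condExp.congr (hcond i)).symm
    _ = ∫ _, 1 ∂P := by
      refine integral_congr_ae (hsum.mono fun ω hω => ?_)
      simp only [← Finset.sum_div, div_self hω]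
    _ = 1 := by simp
  rw [measureReal_def, ENNReal.toReal_eq_one_iff] at hprob
  exact (mem_ae_iff_prob_eq_one hm).mpr hprob

-- A renewal whose type has rate zero is a null event.
lemma ae_polyaReachable (h : IsPolyaClock A x₀ P T I) (hten : PolyaTenable A x₀) :
    ∀ᵐ ω ∂P, ∀ n, PolyaReachable A x₀ (polyaPosition A x₀ I n ω) := by
  refine ae_all_iff.mpr fun n => ?_
  induction n with
  | zero => exact ae_of_all _ fun _ => .start
  | succ n ih =>
    have htime := h.ae_time_pos_of_sum_ne_zero (ih.mono fun ω hω => (hten.sum_pos hω).ne')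
    have hnull (i : Fin c) :
        P ({ω | polyaPosition A x₀ I n ω i = 0} ∩ {ω | 0 < T n ω ∧ I n ω = i}) = 0 := by
      have hB : MeasurableSet[polyaHistory T I n] {ω | polyaPosition A x₀ I n ω i = 0} :=
        (measurable_pi_apply i).comp measurable_polyaPosition_polyaHistory
          (measurableSet_singleton (0 : ℝ))
      rw [← measureReal_eq_zero_iff, h.measureReal_inter_lt_time_and_type_eq le_rfl i hB]
      refine setIntegral_eq_zero_of_forall_eq_zero fun ω (hω : polyaPosition A x₀ I n ω i = 0) => ?_
      rw [hω, zero_div, mul_zero]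
    filter_upwards [ih, htime, ae_all_iff.mpr fun i => measure_eq_zero_iff_ae_notMem.mp (hnull i)]
      with ω hreach hpos hzero
    exact .step _ hreach (((hten _ hreach).2 _).lt_of_ne fun h0 => hzero _ ⟨h0.symm, hpos, rfl⟩)

lemma ae_time_pos (h : IsPolyaClock A x₀ P T I) (hten : PolyaTenable A x₀) :
    ∀ᵐ ω ∂P, ∀ n, 0 < T n ω :=
  ae_all_iff.mpr fun n => h.ae_time_pos_of_sum_ne_zero <|
    (h.ae_polyaReachable hten).mono fun _ hω => (hten.sum_pos (hω n)).ne'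

lemma ae_polyaRenewalTime_nonneg (h : IsPolyaClock A x₀ P T I) (hten : PolyaTenable A x₀) :
    ∀ᵐ ω ∂P, ∀ n, 0 ≤ polyaRenewalTime T n ω :=
  (h.ae_time_pos hten).mono fun _ hω _ => Finset.sum_nonneg fun k _ => (hω k).le

section OneStepLaw

variable {Ω : Type*} {mΩ : MeasurableSpace Ω} {c : ℕ} {A : Matrix (Fin c) (Fin c) ℝ}
  {x₀ : Fin c → ℝ} {P : Measure Ω} [IsProbabilityMeasure P] {T : ℕ → Ω → ℝ} {I : ℕ → Ω → Fin c}

lemma integrable_polyaPosition_div (h : IsPolyaClock A x₀ P T I) (hten : PolyaTenable A x₀)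
    (hA : ∀ i, ∑ j, A i j = 0) (n : ℕ) (i : Fin c) :
    Integrable (fun ω => polyaPosition A x₀ I n ω i / ∑ j, x₀ j) P := by
  refine (integrable_condExp.congr (h.cond_law n i 0 le_rfl)).congr ?_
  filter_upwards [h.ae_polyaReachable hten] with ω hω
  rw [(hω n).sum_eq hA, zero_mul, neg_zero, Real.exp_zero, one_mul]

lemma measure_inter_lt_time_and_type_eq (h : IsPolyaClock A x₀ P T I) (hten : PolyaTenable A x₀)
    (hA : ∀ i, ∑ j, A i j = 0) {n : ℕ} (i : Fin c) {B : Set Ω}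
    (hB : MeasurableSet[polyaHistory T I n] B) (s : ℝ) :
    P (B ∩ {ω | s < T n ω ∧ I n ω = i}) =
      (∫⁻ ω in B, ENNReal.ofReal (polyaPosition A x₀ I n ω i / ∑ j, x₀ j) ∂P) *
        expMeasure (∑ j, x₀ j) (Set.Ioi s) := by
  have hΛ := hten.sum_pos .start
  have hreach := h.ae_polyaReachable hten
  have hpos : (B ∩ {ω | s < T n ω ∧ I n ω = i} : Set Ω) =ᵐ[P]
      (B ∩ {ω | max s 0 < T n ω ∧ I n ω = i} : Set Ω) := by
    filter_upwards [h.ae_time_pos hten] with ω hω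
    refine propext (and_congr_right fun _ => and_congr_left fun _ => ?_)
    rw [max_lt_iff, and_iff_left (hω n)]
  have hint := (h.integrable_polyaPosition_div hten hA n i).restrict (s := B)
  rw [measure_congr hpos, ← ofReal_measureReal,
    h.measureReal_inter_lt_time_and_type_eq (le_max_right s 0) i hB, expMeasure_Ioi hΛ, mul_comm,
    ← ofReal_integral_eq_lintegral_ofReal hint, ← ENNReal.ofReal_mul (Real.exp_pos _).le,
    ← integral_const_mul]
  · refine congrArg _ (integral_congr_ae (ae_restrict_of_ae (hreach.mono fun ω hω => ?_)))
    simp only [(hω n).sum_eq hA]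
  · exact ae_restrict_of_ae (hreach.mono fun ω hω => div_nonneg ((hten _ (hω n)).2 i) hΛ.le)

lemma map_restrict_type_eq_prod (h : IsPolyaClock A x₀ P T I) (hten : PolyaTenable A x₀)
    (hA : ∀ i, ∑ j, A i j = 0) {n : ℕ} (i : Fin c) {α : Type*} [MeasurableSpace α] {W : Ω → α}
    (hW : Measurable[polyaHistory T I n] W) :
    (P.restrict {ω | I n ω = i}).map (fun ω => (W ω, T n ω)) =
      ((P.withDensity fun ω => ENNReal.ofReal (polyaPosition A x₀ I n ω i / ∑ j, x₀ j)).map W).prod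
        (expMeasure (∑ j, x₀ j)) := by
  have hWΩ : Measurable W := hW.mono (h.polyaHistory_le n) le_rfl
  have := isProbabilityMeasure_expMeasure (hten.sum_pos .start)
  have := isFiniteMeasure_withDensity_ofReal (h.integrable_polyaPosition_div hten hA n i).2
  let rays : (expMeasure (∑ j, x₀ j)).FiniteSpanningSetsIn (Set.range Set.Ioi) :=
    ⟨fun k => Set.Ioi (-k), fun k => ⟨_, rfl⟩, fun _ => measure_lt_top _ _,
      Set.iUnion_eq_univ_iff.mpr fun x => (exists_nat_gt (-x)).imp fun _ hk => neg_lt.mp hk⟩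
  refine (Measure.prod_eq_generateFrom MeasurableSpace.generateFrom_measurableSet
    (borel_eq_generateFrom_Ioi ℝ).symm MeasurableSpace.isPiSystem_measurableSet isPiSystem_Ioi
    (Measure.toFiniteSpanningSetsIn _) rays ?_).symm
  rintro B hB _ ⟨s, rfl⟩
  rw [Measure.map_apply (hWΩ.prodMk (h.measurable_time n)) (hB.prod measurableSet_Ioi),
    Measure.restrict_apply (hWΩ.prodMk (h.measurable_time n) (hB.prod measurableSet_Ioi)),
    Measure.map_apply hWΩ hB, withDensity_apply _ (hWΩ hB),
    ← h.measure_inter_lt_time_and_type_eq hten hA i (hW hB) s]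
  congr 1
  ext ω
  simp [and_assoc]

variable {n : ℕ} {α E : Type*} [MeasurableSpace α] {W : Ω → α} [NormedAddCommGroup E]

lemma integrable_prod_of_integrableOn_type_eq (h : IsPolyaClock A x₀ P T I)
    (hten : PolyaTenable A x₀) (hA : ∀ i, ∑ j, A i j = 0) {i : Fin c}
    (hW : Measurable[polyaHistory T I n] W) {f : α × ℝ → E} (hf : StronglyMeasurable f)
    (hint : IntegrableOn (fun ω => f (W ω, T n ω)) {ω | I n ω = i} P) :
    Integrable f (((P.withDensity fun ω =>
      ENNReal.ofReal (polyaPosition A x₀ I n ω i / ∑ j, x₀ j)).map W).prod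
        (expMeasure (∑ j, x₀ j))) := by
  have hWT := (hW.mono (h.polyaHistory_le n) le_rfl).prodMk (h.measurable_time n)
  rw [← h.map_restrict_type_eq_prod hten hA i hW]
  exact (integrable_map_measure hf.aestronglyMeasurable hWT.aemeasurable).mpr hint

variable [NormedSpace ℝ E]

lemma toReal_ofReal_polyaPosition_div_smul_ae_eq (h : IsPolyaClock A x₀ P T I)
    (hten : PolyaTenable A x₀) (i : Fin c) (g : Ω → E) :
    (fun ω => (ENNReal.ofReal (polyaPosition A x₀ I n ω i / ∑ j, x₀ j)).toReal • g ω) =ᵐ[P]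
      fun ω => (polyaPosition A x₀ I n ω i / ∑ j, x₀ j) • g ω := by
  filter_upwards [h.ae_polyaReachable hten] with ω hω
  rw [ENNReal.toReal_ofReal (div_nonneg ((hten _ (hω n)).2 i) (hten.sum_pos .start).le)]

lemma integrable_smul_integral_expMeasure (h : IsPolyaClock A x₀ P T I)
    (hten : PolyaTenable A x₀) (hA : ∀ i, ∑ j, A i j = 0) {i : Fin c}
    (hW : Measurable[polyaHistory T I n] W) {f : α × ℝ → E} (hf : StronglyMeasurable f)
    (hint : IntegrableOn (fun ω => f (W ω, T n ω)) {ω | I n ω = i} P) :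
    Integrable (fun ω => (polyaPosition A x₀ I n ω i / ∑ j, x₀ j) •
      ∫ s, f (W ω, s) ∂(expMeasure (∑ j, x₀ j))) P := by
  have hWΩ : Measurable W := hW.mono (h.polyaHistory_le n) le_rfl
  have := isProbabilityMeasure_expMeasure (hten.sum_pos .start)
  have hprod := (h.integrable_prod_of_integrableOn_type_eq hten hA hW hf hint).integral_prod_left
  have hdens := (integrable_withDensity_iff_integrable_smul₀'
    (h.integrable_polyaPosition_div hten hA n i).1.aemeasurable.ennreal_ofReal
    (ae_of_all _ fun _ => ENNReal.ofReal_lt_top)).mp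
      ((integrable_map_measure hprod.aestronglyMeasurable hWΩ.aemeasurable).mp hprod)
  exact hdens.congr (h.toReal_ofReal_polyaPosition_div_smul_ae_eq hten i _)

lemma setIntegral_type_eq (h : IsPolyaClock A x₀ P T I)
    (hten : PolyaTenable A x₀) (hA : ∀ i, ∑ j, A i j = 0) {i : Fin c}
    (hW : Measurable[polyaHistory T I n] W) {f : α × ℝ → E} (hf : StronglyMeasurable f)
    (hint : IntegrableOn (fun ω => f (W ω, T n ω)) {ω | I n ω = i} P) :
    ∫ ω in {ω | I n ω = i}, f (W ω, T n ω) ∂P =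
      ∫ ω, (polyaPosition A x₀ I n ω i / ∑ j, x₀ j) •
        ∫ s, f (W ω, s) ∂(expMeasure (∑ j, x₀ j)) ∂P := by
  have hWΩ : Measurable W := hW.mono (h.polyaHistory_le n) le_rfl
  have := isProbabilityMeasure_expMeasure (hten.sum_pos .start)
  rw [← integral_map_of_stronglyMeasurable (hWΩ.prodMk (h.measurable_time n)) hf,
    h.map_restrict_type_eq_prod hten hA i hW,
    integral_prod _ (h.integrable_prod_of_integrableOn_type_eq hten hA hW hf hint),
    integral_map_of_stronglyMeasurable hWΩ hf.integral_prod_right',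
    integral_withDensity_eq_integral_toReal_smul₀
      (h.integrable_polyaPosition_div hten hA n i).1.aemeasurable.ennreal_ofReal
      (ae_of_all _ fun _ => ENNReal.ofReal_lt_top)]
  exact integral_congr_ae (h.toReal_ofReal_polyaPosition_div_smul_ae_eq hten i _)

-- The strong Markov property at the `n`-th renewal.
lemma integral_history_time_type (h : IsPolyaClock A x₀ P T I) (hten : PolyaTenable A x₀)
    (hA : ∀ i, ∑ j, A i j = 0) (hW : Measurable[polyaHistory T I n] W)
    {f : Fin c → α × ℝ → E} (hf : ∀ i, StronglyMeasurable (f i))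
    (hint : Integrable (fun ω => f (I n ω) (W ω, T n ω)) P) :
    ∫ ω, f (I n ω) (W ω, T n ω) ∂P =
      ∫ ω, ∑ i, (polyaPosition A x₀ I n ω i / ∑ j, x₀ j) •
        ∫ s, f i (W ω, s) ∂(expMeasure (∑ j, x₀ j)) ∂P := by
  have hm (i : Fin c) : MeasurableSet {ω | I n ω = i} :=
    h.measurable_type n (measurableSet_singleton i)
  have hon (i : Fin c) : Set.EqOn (fun ω => f (I n ω) (W ω, T n ω)) (fun ω => f i (W ω, T n ω))
      {ω | I n ω = i} := fun ω (hω : I n ω = i) => by simp only [hω]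
  have hinti (i : Fin c) : IntegrableOn (fun ω => f i (W ω, T n ω)) {ω | I n ω = i} P :=
    hint.integrableOn.congr_fun (hon i) (hm i)
  have hdisj : Pairwise (Function.onFun Disjoint fun i => {ω | I n ω = i}) :=
    fun i j hij => Set.disjoint_left.mpr fun ω hi hj => hij (hi.symm.trans hj)
  calc ∫ ω, f (I n ω) (W ω, T n ω) ∂P
    _ = ∫ ω in ⋃ i, {ω | I n ω = i}, f (I n ω) (W ω, T n ω) ∂P := by
      rw [Set.iUnion_eq_univ_iff.mpr fun ω => ⟨I n ω, rfl⟩, setIntegral_univ]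
    _ = ∑ i, ∫ ω in {ω | I n ω = i}, f (I n ω) (W ω, T n ω) ∂P :=
      integral_iUnion_fintype hm hdisj fun i => hint.integrableOn
    _ = ∑ i, ∫ ω, (polyaPosition A x₀ I n ω i / ∑ j, x₀ j) •
          ∫ s, f i (W ω, s) ∂(expMeasure (∑ j, x₀ j)) ∂P :=
      Finset.sum_congr rfl fun i _ => (setIntegral_congr_fun (hm i) (hon i)).trans
        (h.setIntegral_type_eq hten hA hW (hf i) (hinti i))
    _ = _ := (integral_finsetSum _ fun i _ =>
      h.integrable_smul_integral_expMeasure hten hA hW (hf i) (hinti i)).symm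

end OneStepLaw
end IsPolyaClock

section NonExplosion

variable {Ω : Type*} {mΩ : MeasurableSpace Ω} {c : ℕ} {A : Matrix (Fin c) (Fin c) ℝ}
  {x₀ : Fin c → ℝ} {P : Measure Ω} [IsProbabilityMeasure P] {T : ℕ → Ω → ℝ} {I : ℕ → Ω → Fin c}

namespace IsPolyaClock

lemma ae_sum_polyaPosition_div (h : IsPolyaClock A x₀ P T I) (hten : PolyaTenable A x₀)
    (hA : ∀ i, ∑ j, A i j = 0) :
    ∀ᵐ ω ∂P, ∀ n, ∑ i, polyaPosition A x₀ I n ω i / ∑ j, x₀ j = 1 := by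
  filter_upwards [h.ae_polyaReachable hten] with ω hω n
  rw [← Finset.sum_div, (hω n).sum_eq hA, div_self (hten.sum_pos .start).ne']

lemma integrable_exp_neg_polyaRenewalTime (h : IsPolyaClock A x₀ P T I)
    (hten : PolyaTenable A x₀) (n : ℕ) :
    Integrable (fun ω => Real.exp (-polyaRenewalTime T n ω)) P := by
  have hm := h.measurable_polyaRenewalTime n
  refine .of_bound (by fun_prop) 1 ((h.ae_polyaRenewalTime_nonneg hten).mono fun ω hω => ?_)
  rw [Real.norm_eq_abs, Real.abs_exp, Real.exp_le_one_iff, neg_nonpos]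
  exact hω n

lemma integral_exp_neg_polyaRenewalTime (h : IsPolyaClock A x₀ P T I) (hten : PolyaTenable A x₀)
    (hA : ∀ i, ∑ j, A i j = 0) (n : ℕ) :
    ∫ ω, Real.exp (-polyaRenewalTime T n ω) ∂P = ((∑ j, x₀ j) / (∑ j, x₀ j + 1)) ^ n := by
  induction n with
  | zero => simp [polyaRenewalTime]
  | succ n ih =>
    have hint := h.integrable_exp_neg_polyaRenewalTime hten (n + 1)
    simp only [polyaRenewalTime_succ] at hint ⊢
    rw [h.integral_history_time_type hten hA (measurable_polyaRenewalTime_polyaHistory T I n)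
      (f := fun _ p => Real.exp (-(p.1 + p.2))) (fun _ => by fun_prop) hint, pow_succ, ← ih,
      ← integral_mul_const]
    refine integral_congr_ae ((h.ae_sum_polyaPosition_div hten hA).mono fun ω hω => ?_)
    simp only [neg_add, Real.exp_add, integral_const_mul, ← Finset.sum_smul, hω n, one_smul,
      integral_exp_neg_expMeasure (hten.sum_pos .start)]

lemma ae_tendsto_polyaRenewalTime_atTop (h : IsPolyaClock A x₀ P T I) (hten : PolyaTenable A x₀)
    (hA : ∀ i, ∑ j, A i j = 0) :
    ∀ᵐ ω ∂P, Tendsto (fun n => polyaRenewalTime T n ω) atTop atTop := by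
  have hΛ := hten.sum_pos .start
  have hm (n : ℕ) := h.measurable_polyaRenewalTime n
  have hsum : Summable fun n : ℕ => ((∑ j, x₀ j) / (∑ j, x₀ j + 1)) ^ n :=
    summable_geometric_of_lt_one (by positivity) ((div_lt_one (by positivity)).mpr (lt_add_one _))
  have hfin : ∫⁻ ω, ∑' n, ENNReal.ofReal (Real.exp (-polyaRenewalTime T n ω)) ∂P ≠ ⊤ := by
    rw [lintegral_tsum fun n => by fun_prop]
    simp only [← ofReal_integral_eq_lintegral_ofReal (h.integrable_exp_neg_polyaRenewalTime hten _)
      (ae_of_all _ fun _ => (Real.exp_pos _).le), h.integral_exp_neg_polyaRenewalTime hten hA]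
    exact hsum.tsum_ofReal_ne_top
  filter_upwards [ae_lt_top' (by fun_prop) hfin] with ω hω
  have hzero := ENNReal.tendsto_atTop_zero_of_tsum_ne_top hω.ne
  have := (ENNReal.tendsto_toReal ENNReal.zero_ne_top).comp hzero
  simp only [Function.comp_def, ENNReal.toReal_ofReal (Real.exp_pos _).le, ENNReal.toReal_zero]
    at this
  exact tendsto_neg_atBot_iff.mp (Real.tendsto_exp_comp_nhds_zero.mp this)

lemma ae_exists_polyaRenewalTime_le_lt (h : IsPolyaClock A x₀ P T I) (hten : PolyaTenable A x₀)
    (hA : ∀ i, ∑ j, A i j = 0) :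
    ∀ᵐ ω ∂P, ∀ t : ℝ≥0, ∃ n, polyaRenewalTime T n ω ≤ t ∧ t < polyaRenewalTime T (n + 1) ω := by
  filter_upwards [h.ae_tendsto_polyaRenewalTime_atTop hten hA] with ω hω t
  by_contra! hstay
  have hle (n : ℕ) : polyaRenewalTime T n ω ≤ t := by
    induction n with
    | zero => simp [polyaRenewalTime]
    | succ n ih => exact hstay n ih
  obtain ⟨n, hn⟩ := (hω.eventually_gt_atTop (t : ℝ)).exists
  exact (hle n).not_gt hn

end IsPolyaClock

namespace IsPolyaWalk

variable {X : ℝ≥0 → Ω → Fin c → ℝ}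

lemma ae_polyaReachable (h : IsPolyaWalk A x₀ P X) (hten : PolyaTenable A x₀)
    (hA : ∀ i, ∑ j, A i j = 0) : ∀ᵐ ω ∂P, ∀ t, PolyaReachable A x₀ (X t ω) := by
  obtain ⟨T, I, hc, hX⟩ := h
  filter_upwards [hX, hc.ae_polyaReachable hten, hc.ae_exists_polyaRenewalTime_le_lt hten hA]
    with ω hXω hreach hex t
  obtain ⟨n, hn, hn'⟩ := hex t
  exact hXω n t hn hn' ▸ hreach n

lemma aemeasurable (h : IsPolyaWalk A x₀ P X) (hten : PolyaTenable A x₀)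
    (hA : ∀ i, ∑ j, A i j = 0) (t : ℝ≥0) : AEMeasurable (X t) P := by
  obtain ⟨T, I, hc, hX⟩ := h
  let S (n : ℕ) : Set Ω := {ω | polyaRenewalTime T n ω ≤ t ∧ t < polyaRenewalTime T (n + 1) ω}
  have hS (n : ℕ) : MeasurableSet (S n) :=
    (measurableSet_le (hc.measurable_polyaRenewalTime n) measurable_const).inter
      (measurableSet_lt measurable_const (hc.measurable_polyaRenewalTime (n + 1)))
  have hcover : ⋃ n, S n =ᵐ[P] (Set.univ : Set Ω) :=
    eventuallyEq_univ.mpr <| (hc.ae_exists_polyaRenewalTime_le_lt hten hA).mono fun ω hω =>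
      Set.mem_iUnion.mpr (hω t)
  rw [← Measure.restrict_univ (μ := P), ← Measure.restrict_congr_set hcover,
    aemeasurable_iUnion_iff]
  refine fun n => ⟨polyaPosition A x₀ I n, measurable_polyaPosition fun k _ => hc.measurable_type k,
    ?_⟩
  filter_upwards [ae_restrict_of_ae hX, ae_restrict_mem (hS n)] with ω hXω hω
  exact hXω n t hω.1 hω.2

end IsPolyaWalk

end NonExplosion

lemma integral_expMeasure_ite_le {E : Type*} [NormedAddCommGroup E] [NormedSpace ℝ E]
    [CompleteSpace E] {Λ r : ℝ} (hΛ : 0 < Λ) (hr : 0 ≤ r) {f : ℝ → E}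
    (hf : ContinuousOn f (Set.Icc 0 r)) (a : E) :
    ∫ s, (if s ≤ r then f s else a) ∂(expMeasure Λ) =
      Λ • (∫ s in 0..r, Real.exp (-(Λ * s)) • f s) + Real.exp (-(Λ * r)) • a := by
  have hexp (s : ℝ) : Real.exp (-(Λ * s)) = Real.exp (-Λ * s) := by rw [neg_mul]
  have hleft : Set.EqOn (fun s => (Λ * Real.exp (-(Λ * s))) • if s ≤ r then f s else a)
      (fun s => Λ • Real.exp (-(Λ * s)) • f s) (Set.Ioc 0 r) := fun s hs => by
    simp only [if_pos hs.2, mul_smul]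
  have hright : Set.EqOn (fun s => (Λ * Real.exp (-(Λ * s))) • if s ≤ r then f s else a)
      (fun s => (Λ * Real.exp (-Λ * s)) • a) (Set.Ioi r) := fun s hs => by
    simp only [if_neg (Set.mem_Ioi.mp hs).not_ge, hexp]
  have hcont : ContinuousOn (fun s => Λ • Real.exp (-(Λ * s)) • f s) (Set.Icc 0 r) := by fun_prop
  rw [integral_expMeasure hΛ, ← Set.Ioc_union_Ioi_eq_Ioi hr,
    setIntegral_union (Set.Ioc_disjoint_Ioi le_rfl) measurableSet_Ioi,
    setIntegral_congr_fun measurableSet_Ioc hleft, setIntegral_congr_fun measurableSet_Ioi hright,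
    integral_smul, ← intervalIntegral.integral_of_le hr, integral_smul_const, integral_const_mul,
    integral_exp_mul_Ioi (neg_lt_zero.mpr hΛ), neg_div_neg_eq, mul_div_cancel₀ _ hΛ.ne', hexp]
  · exact (hcont.integrableOn_Icc.mono_set Set.Ioc_subset_Icc_self).congr_fun hleft.symm
      measurableSet_Ioc
  · have hexpint := (integrableOn_exp_mul_Ioi (neg_lt_zero.mpr hΛ) r).const_mul Λ
    exact IntegrableOn.congr_fun (hexpint.smul_const a) hright.symm measurableSet_Ioi

/-- `u r z` is a solution, bounded on bounded time intervals, of Kolmogorov's backward equation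
`∂u/∂r = ∑ i, z i • (u r (z + A i) - u r z)` of the walk with navigation matrix `A` started at
`x₀`. Only positions `z` which the walk can visit matter. -/
structure IsPolyaBackwardSolution {c : ℕ} {E : Type*} [NormedAddCommGroup E] [NormedSpace ℝ E]
    (A : Matrix (Fin c) (Fin c) ℝ) (x₀ : Fin c → ℝ) (u : ℝ → (Fin c → ℝ) → E) : Prop where
  stronglyMeasurable : StronglyMeasurable (Function.uncurry u)
  hasDerivAt : ∀ r, 0 ≤ r → ∀ z, PolyaReachable A x₀ z →
    HasDerivAt (fun r => u r z) (∑ i, z i • (u r (z + A i) - u r z)) r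
  bounded : ∀ t, ∃ C, ∀ r ∈ Set.Icc 0 t, ∀ z, PolyaReachable A x₀ z → ‖u r z‖ ≤ C

section BackwardEquation

variable {c : ℕ} {E : Type*} [NormedAddCommGroup E] [NormedSpace ℝ E]
  {A : Matrix (Fin c) (Fin c) ℝ} {x₀ z : Fin c → ℝ} {u : ℝ → (Fin c → ℝ) → E} {r : ℝ}

namespace IsPolyaBackwardSolution

lemma continuousOn_sub (hu : IsPolyaBackwardSolution A x₀ u) (hz : PolyaReachable A x₀ z) :
    ContinuousOn (fun s => u (r - s) z) (Set.Icc 0 r) := by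
  have hcont : ContinuousOn (fun r => u r z) (Set.Ici 0) := fun r hr =>
    (hu.hasDerivAt r hr z hz).continuousAt.continuousWithinAt
  exact hcont.comp (by fun_prop) fun s hs => sub_nonneg.mpr hs.2

lemma continuousOn_smul_sub (hu : IsPolyaBackwardSolution A x₀ u) (hten : PolyaTenable A x₀)
    (hz : PolyaReachable A x₀ z) (i : Fin c) :
    ContinuousOn (fun s => z i • u (r - s) (z + A i)) (Set.Icc 0 r) := by
  rcases ((hten z hz).2 i).eq_or_lt with hi | hi
  · simpa only [← hi, zero_smul] using continuousOn_const
  · exact (hu.continuousOn_sub (hz.step i hi)).const_smul _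

variable [CompleteSpace E]

lemma integral_exp_smul_sum (hu : IsPolyaBackwardSolution A x₀ u) (hten : PolyaTenable A x₀)
    (hz : PolyaReachable A x₀ z) (hr : 0 ≤ r) :
    ∫ s in 0..r, Real.exp (-((∑ j, z j) * s)) • ∑ i, z i • u (r - s) (z + A i) =
      u r z - Real.exp (-((∑ j, z j) * r)) • u 0 z := by
  set Λ := ∑ j, z j with hΛ
  have hderiv (s : ℝ) (hs : s ∈ Set.uIcc 0 r) :
      HasDerivAt (fun s => -(Real.exp (-(Λ * s)) • u (r - s) z))
        (Real.exp (-(Λ * s)) • ∑ i, z i • u (r - s) (z + A i)) s := by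
    rw [Set.uIcc_of_le hr] at hs
    have hexp : HasDerivAt (fun s => Real.exp (-(Λ * s))) (Real.exp (-(Λ * s)) * -(Λ * 1)) s :=
      ((hasDerivAt_id s).const_mul Λ).neg.exp
    have hu' := (hu.hasDerivAt (r - s) (sub_nonneg.mpr hs.2) z hz).scomp s
      ((hasDerivAt_id s).const_sub r)
    refine (hexp.smul hu').neg.congr_deriv ?_
    simp only [smul_sub, Finset.sum_sub_distrib, ← Finset.sum_smul, ← hΛ, Function.comp_apply]
    module
  have hcont : ContinuousOn
      (fun s => Real.exp (-(Λ * s)) • ∑ i, z i • u (r - s) (z + A i)) (Set.uIcc 0 r) := by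
    rw [Set.uIcc_of_le hr]
    exact ContinuousOn.smul (by fun_prop)
      (continuousOn_finsetSum _ fun i _ => hu.continuousOn_smul_sub hten hz i)
  rw [intervalIntegral.integral_eq_sub_of_hasDerivAt hderiv hcont.intervalIntegrable]
  simp only [sub_self, sub_zero, mul_zero, neg_zero, Real.exp_zero, one_smul]
  abel

-- Conditioning on the first renewal.
lemma sum_smul_integral_expMeasure (hu : IsPolyaBackwardSolution A x₀ u)
    (hten : PolyaTenable A x₀) (hz : PolyaReachable A x₀ z) (hr : 0 ≤ r) :
    ∑ i, (z i / ∑ j, z j) •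
      ∫ s, (if s ≤ r then u (r - s) (z + A i) else u 0 z) ∂(expMeasure (∑ j, z j)) = u r z := by
  have hpos := hten.sum_pos hz
  have hterm (i : Fin c) : (z i / ∑ j, z j) •
      ∫ s, (if s ≤ r then u (r - s) (z + A i) else u 0 z) ∂(expMeasure (∑ j, z j)) =
      (∫ s in 0..r, Real.exp (-((∑ j, z j) * s)) • z i • u (r - s) (z + A i)) +
        (z i / ∑ j, z j) • Real.exp (-((∑ j, z j) * r)) • u 0 z := by
    rcases ((hten z hz).2 i).eq_or_lt with hi | hi
    · simp [← hi]
    · rw [integral_expMeasure_ite_le hpos hr (hu.continuousOn_sub (hz.step i hi)), smul_add,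
        smul_smul, div_mul_cancel₀ _ hpos.ne', ← intervalIntegral.integral_smul]
      simp only [smul_comm (z i)]
  have hint (i : Fin c) : IntervalIntegrable
      (fun s => Real.exp (-((∑ j, z j) * s)) • z i • u (r - s) (z + A i)) volume 0 r := by
    refine ContinuousOn.intervalIntegrable ?_
    rw [Set.uIcc_of_le hr]
    exact ContinuousOn.smul (by fun_prop) (hu.continuousOn_smul_sub hten hz i)
  simp only [hterm, Finset.sum_add_distrib, ← Finset.sum_smul, ← Finset.sum_div,
    div_self hpos.ne', one_smul]
  rw [← intervalIntegral.integral_finsetSum fun i _ => hint i]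
  simp only [← Finset.smul_sum]
  rw [hu.integral_exp_smul_sum hten hz hr, sub_add_cancel]

end IsPolyaBackwardSolution

end BackwardEquation

section Martingale

variable {Ω : Type*} {mΩ : MeasurableSpace Ω} {c : ℕ} {A : Matrix (Fin c) (Fin c) ℝ}
  {x₀ : Fin c → ℝ} {P : Measure Ω} {T : ℕ → Ω → ℝ} {I : ℕ → Ω → Fin c}
  {E : Type*} {u : ℝ → (Fin c → ℝ) → E} {t : ℝ} {Y : Ω → Fin c → ℝ}

/-- The space-time function `u` along the walk, seen at its `n`-th renewal when the time left until
`t` is counted down. From the first renewal after `t` on, it is frozen at `u 0 Y`, where `Y` stands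
for the position of the walk at time `t`. It is a martingale in `n` if `u` solves the backward
equation. -/
noncomputable def polyaStoppedValue (A : Matrix (Fin c) (Fin c) ℝ) (x₀ : Fin c → ℝ)
    (T : ℕ → Ω → ℝ) (I : ℕ → Ω → Fin c) (u : ℝ → (Fin c → ℝ) → E) (t : ℝ) (Y : Ω → Fin c → ℝ)
    (n : ℕ) (ω : Ω) : E :=
  if polyaRenewalTime T n ω ≤ t then u (t - polyaRenewalTime T n ω) (polyaPosition A x₀ I n ω)
  else u 0 (Y ω)

/-- What `polyaStoppedValue` becomes after a renewal of type `i` for which the walk has waited at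
`z` from time `τ` on during the time `s`, where `p = ((τ, z), s)`; it is cut off to `0` if `t` lies
before `τ`. -/
noncomputable def polyaValueAfterRenewal [Zero E] (A : Matrix (Fin c) (Fin c) ℝ)
    (u : ℝ → (Fin c → ℝ) → E) (t : ℝ) (i : Fin c) (p : (ℝ × (Fin c → ℝ)) × ℝ) : E :=
  if p.1.1 ≤ t then if p.2 ≤ t - p.1.1 then u (t - p.1.1 - p.2) (p.1.2 + A i) else u 0 p.1.2 else 0

variable [NormedAddCommGroup E]

lemma stronglyMeasurable_polyaValueAfterRenewal (hu : StronglyMeasurable (Function.uncurry u))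
    (t : ℝ) (i : Fin c) : StronglyMeasurable (polyaValueAfterRenewal A u t i) := by
  refine .ite (measurableSet_le (by fun_prop) (by fun_prop))
    (.ite (measurableSet_le (by fun_prop) (by fun_prop)) ?_ ?_) stronglyMeasurable_const
  · exact hu.comp_measurable (g := fun p : (ℝ × (Fin c → ℝ)) × ℝ =>
      (t - p.1.1 - p.2, p.1.2 + A i)) (by fun_prop)
  · exact hu.comp_measurable (g := fun p : (ℝ × (Fin c → ℝ)) × ℝ => ((0 : ℝ), p.1.2))
      (by fun_prop)

lemma indicator_polyaStoppedValue_succ (n : ℕ) (ω : Ω) :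
    Set.indicator {ω | polyaRenewalTime T n ω ≤ t}
        (polyaStoppedValue A x₀ T I u t (polyaPosition A x₀ I n) (n + 1)) ω =
      polyaValueAfterRenewal A u t (I n ω)
        ((polyaRenewalTime T n ω, polyaPosition A x₀ I n ω), T n ω) := by
  simp only [Set.indicator_apply, Set.mem_ofPred_eq, polyaValueAfterRenewal, polyaStoppedValue,
    polyaRenewalTime_succ, le_sub_iff_add_le', sub_add_eq_sub_sub, polyaPosition]

namespace IsPolyaClock

lemma aestronglyMeasurable_polyaStoppedValue (h : IsPolyaClock A x₀ P T I)
    (hu : StronglyMeasurable (Function.uncurry u)) (hY : AEMeasurable Y P) (t : ℝ) (n : ℕ) :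
    AEStronglyMeasurable (polyaStoppedValue A x₀ T I u t Y n) P := by
  have hτ := h.measurable_polyaRenewalTime n
  have hZ : Measurable (polyaPosition A x₀ I n) :=
    measurable_polyaPosition fun k _ => h.measurable_type k
  have hlive := hu.comp_measurable ((hτ.const_sub t).prodMk hZ)
  have hfrozen := hu.aestronglyMeasurable.comp_aemeasurable
    ((aemeasurable_const (b := (0 : ℝ))).prodMk hY)
  classical
  exact (AEStronglyMeasurable.piecewise (h.measurableSet_polyaRenewalTime_le n t)
    hlive.aestronglyMeasurable.restrict hfrozen.restrict).congr (ae_of_all _ fun ω => by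
      simp [Set.piecewise, polyaStoppedValue])

variable [IsProbabilityMeasure P] [NormedSpace ℝ E]

lemma exists_ae_norm_polyaStoppedValue_le (h : IsPolyaClock A x₀ P T I)
    (hten : PolyaTenable A x₀) (hu : IsPolyaBackwardSolution A x₀ u) (ht : 0 ≤ t)
    (hY : ∀ᵐ ω ∂P, PolyaReachable A x₀ (Y ω)) :
    ∃ C, ∀ᵐ ω ∂P, ∀ n, ‖polyaStoppedValue A x₀ T I u t Y n ω‖ ≤ C := by
  obtain ⟨C, hC⟩ := hu.bounded t
  refine ⟨C, ?_⟩
  filter_upwards [h.ae_polyaReachable hten, h.ae_polyaRenewalTime_nonneg hten, hY]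
    with ω hreach hτ hYω n
  rw [polyaStoppedValue]
  split_ifs with hle
  · exact hC _ ⟨sub_nonneg.mpr hle, sub_le_self t (hτ n)⟩ _ (hreach n)
  · exact hC 0 ⟨le_rfl, ht⟩ _ hYω

lemma integrable_polyaStoppedValue (h : IsPolyaClock A x₀ P T I) (hten : PolyaTenable A x₀)
    (hu : IsPolyaBackwardSolution A x₀ u) (ht : 0 ≤ t) (hYm : AEMeasurable Y P)
    (hY : ∀ᵐ ω ∂P, PolyaReachable A x₀ (Y ω)) (n : ℕ) :
    Integrable (polyaStoppedValue A x₀ T I u t Y n) P := by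
  obtain ⟨C, hC⟩ := h.exists_ae_norm_polyaStoppedValue_le hten hu ht hY
  exact .of_bound (h.aestronglyMeasurable_polyaStoppedValue hu.stronglyMeasurable hYm t n) C
    (hC.mono fun ω hω => hω n)

variable [CompleteSpace E]

lemma setIntegral_polyaStoppedValue_succ (h : IsPolyaClock A x₀ P T I) (hten : PolyaTenable A x₀)
    (hA : ∀ i, ∑ j, A i j = 0) (hu : IsPolyaBackwardSolution A x₀ u) (ht : 0 ≤ t) (n : ℕ) :
    ∫ ω in {ω | polyaRenewalTime T n ω ≤ t},
        polyaStoppedValue A x₀ T I u t (polyaPosition A x₀ I n) (n + 1) ω ∂P =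
      ∫ ω in {ω | polyaRenewalTime T n ω ≤ t},
        u (t - polyaRenewalTime T n ω) (polyaPosition A x₀ I n ω) ∂P := by
  have hS := h.measurableSet_polyaRenewalTime_le n t
  have hreach := h.ae_polyaReachable hten
  have hW : Measurable[polyaHistory T I n]
      fun ω => (polyaRenewalTime T n ω, polyaPosition A x₀ I n ω) :=
    (measurable_polyaRenewalTime_polyaHistory T I n).prodMk measurable_polyaPosition_polyaHistory
  have hint := (h.integrable_polyaStoppedValue hten hu ht
    (measurable_polyaPosition fun k _ => h.measurable_type k).aemeasurable
    (hreach.mono fun ω hω => hω n) (n + 1)).indicator hS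
  rw [← integral_indicator hS, ← integral_indicator hS]
  simp only [funext (indicator_polyaStoppedValue_succ n)] at hint ⊢
  rw [h.integral_history_time_type hten hA hW
    (stronglyMeasurable_polyaValueAfterRenewal hu.stronglyMeasurable t) hint]
  refine integral_congr_ae (hreach.mono fun ω hω => ?_)
  simp only [polyaValueAfterRenewal, Set.indicator_apply, Set.mem_ofPred_eq]
  split_ifs with hle
  · rw [← (hω n).sum_eq hA, hu.sum_smul_integral_expMeasure hten (hω n) (sub_nonneg.mpr hle)]
  · simp only [integral_zero, smul_zero, Finset.sum_const_zero]

lemma integral_polyaStoppedValue_succ (h : IsPolyaClock A x₀ P T I) (hten : PolyaTenable A x₀)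
    (hA : ∀ i, ∑ j, A i j = 0) (hu : IsPolyaBackwardSolution A x₀ u) (ht : 0 ≤ t)
    (hYm : AEMeasurable Y P) (hY : ∀ᵐ ω ∂P, PolyaReachable A x₀ (Y ω))
    (hYeq : ∀ᵐ ω ∂P, ∀ n, polyaRenewalTime T n ω ≤ t → t < polyaRenewalTime T (n + 1) ω →
      Y ω = polyaPosition A x₀ I n ω) (n : ℕ) :
    ∫ ω, polyaStoppedValue A x₀ T I u t Y (n + 1) ω ∂P =
      ∫ ω, polyaStoppedValue A x₀ T I u t Y n ω ∂P := by
  have hS := h.measurableSet_polyaRenewalTime_le n t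
  have hint := h.integrable_polyaStoppedValue hten hu ht hYm hY
  rw [← integral_add_compl hS (hint (n + 1)), ← integral_add_compl hS (hint n)]
  congr 1
  · calc
      _ = ∫ ω in {ω | polyaRenewalTime T n ω ≤ t},
          polyaStoppedValue A x₀ T I u t (polyaPosition A x₀ I n) (n + 1) ω ∂P := by
        refine setIntegral_congr_ae hS (hYeq.mono fun ω hω hle => ?_)
        rw [polyaStoppedValue, polyaStoppedValue]
        split_ifs with hle'
        · rfl
        · rw [hω n hle (not_le.mp hle')]
      _ = ∫ ω in {ω | polyaRenewalTime T n ω ≤ t},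
          u (t - polyaRenewalTime T n ω) (polyaPosition A x₀ I n ω) ∂P :=
        h.setIntegral_polyaStoppedValue_succ hten hA hu ht n
      _ = _ := setIntegral_congr_fun hS fun ω hle => (if_pos hle).symm
  · refine setIntegral_congr_ae hS.compl ((h.ae_time_pos hten).mono
      fun ω hpos (hgt : ¬ polyaRenewalTime T n ω ≤ t) => ?_)
    have hgt' : t < polyaRenewalTime T (n + 1) ω :=
      (not_le.mp hgt).trans (by rw [polyaRenewalTime_succ]; exact lt_add_of_pos_right _ (hpos n))
    exact (if_neg hgt'.not_ge).trans (if_neg hgt).symm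

end IsPolyaClock

theorem IsPolyaWalk.integral_eq_of_isPolyaBackwardSolution [IsProbabilityMeasure P]
    [NormedSpace ℝ E] [CompleteSpace E] {X : ℝ≥0 → Ω → Fin c → ℝ} (h : IsPolyaWalk A x₀ P X)
    (hten : PolyaTenable A x₀) (hA : ∀ i, ∑ j, A i j = 0) (hu : IsPolyaBackwardSolution A x₀ u)
    (t : ℝ≥0) :
    ∫ ω, u 0 (X t ω) ∂P = u t x₀ := by
  have hXm := h.aemeasurable hten hA t
  have hXreach := (h.ae_polyaReachable hten hA).mono fun ω hω => hω t
  obtain ⟨T, I, hc, hX⟩ := h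
  let G : ℕ → Ω → E := polyaStoppedValue A x₀ T I u t (X t)
  have hGmeas (n : ℕ) : AEStronglyMeasurable (G n) P :=
    hc.aestronglyMeasurable_polyaStoppedValue hu.stronglyMeasurable hXm t n
  have hconst (n : ℕ) : ∫ ω, G n ω ∂P = u t x₀ := by
    induction n with
    | zero => simp [G, polyaStoppedValue, polyaRenewalTime, polyaPosition]
    | succ n ih =>
      exact (hc.integral_polyaStoppedValue_succ hten hA hu t.2 hXm hXreach
        (hX.mono fun ω hω n => hω n t) n).trans ih
  obtain ⟨C, hC⟩ := hc.exists_ae_norm_polyaStoppedValue_le hten hu t.2 hXreach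
  have hlim : ∀ᵐ ω ∂P, Tendsto (fun n => G n ω) atTop (𝓝 (u 0 (X t ω))) := by
    filter_upwards [hc.ae_tendsto_polyaRenewalTime_atTop hten hA] with ω hω
    refine tendsto_const_nhds.congr' ?_
    filter_upwards [hω.eventually_gt_atTop (t : ℝ)] with n hn
    exact (if_neg hn.not_ge).symm
  have htends := tendsto_integral_of_dominated_convergence (fun _ => C) hGmeas
    (integrable_const C) (fun n => hC.mono fun ω hω => hω n) hlim
  simp only [hconst] at htends
  exact tendsto_nhds_unique htends tendsto_const_nhds

end Martingale

lemma tendsto_exp_neg_two_mul {γ : ℝ} (hγ : 0 < γ) :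
    Tendsto (fun t : ℝ≥0 => Real.exp (-2 * γ * t)) atTop (𝓝 0) :=
  Real.tendsto_exp_atBot.comp <|
    (NNReal.tendsto_coe_atTop.mpr tendsto_id).const_mul_atTop_of_neg (by linarith)

lemma charFun_map_cast_binomial (N : ℕ) (p : unitInterval) (s : ℝ) :
    charFun ((binomial N p).map (fun k : ℕ => (k : ℝ))) s =
      (1 - (p : ℝ) + (p : ℝ) * Complex.exp (s * Complex.I)) ^ N := by
  rw [charFun_apply_real, integral_map (by fun_prop) (by fun_prop), integral_binomial, add_comm,
    add_pow, ← Nat.range_succ_eq_Iic]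
  refine Finset.sum_congr rfl fun k _ => ?_
  rw [mul_pow, ← Complex.exp_nat_mul, Complex.real_smul]
  push_cast
  ring_nf

section EhrenfestState

variable {γ : ℝ} {k m : ℕ}

/-- The position of the Ehrenfest walk with `a` particles in the first urn and `b` particles in the
second one. -/
def ehrenfestState (γ : ℝ) (a b : ℕ) : Fin 2 → ℝ := ![γ * a, γ * b]

lemma sum_ehrenfestMatrix (γ : ℝ) (i : Fin 2) : ∑ j, ehrenfestMatrix γ i j = 0 := by
  fin_cases i <;> simp [ehrenfestMatrix]

lemma ehrenfestMatrix_apply_self (γ : ℝ) (i : Fin 2) : ehrenfestMatrix γ i i = -γ := by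
  fin_cases i <;> simp [ehrenfestMatrix]

lemma ehrenfestState_succ_add_zero (γ : ℝ) (a b : ℕ) :
    ehrenfestState γ (a + 1) b + ehrenfestMatrix γ 0 = ehrenfestState γ a (b + 1) := by
  ext j
  fin_cases j <;> simp [ehrenfestState, ehrenfestMatrix] <;> ring

lemma ehrenfestState_succ_add_one (γ : ℝ) (a b : ℕ) :
    ehrenfestState γ a (b + 1) + ehrenfestMatrix γ 1 = ehrenfestState γ (a + 1) b := by
  ext j
  fin_cases j <;> simp [ehrenfestState, ehrenfestMatrix] <;> ring

lemma PolyaReachable.exists_eq_ehrenfestState {x : Fin 2 → ℝ}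
    (h : PolyaReachable (ehrenfestMatrix γ) (ehrenfestState γ k m) x) :
    ∃ a b : ℕ, a + b = k + m ∧ x = ehrenfestState γ a b := by
  induction h with
  | start => exact ⟨k, m, rfl, rfl⟩
  | step i _ hi ih =>
    obtain ⟨a, b, hab, rfl⟩ := ih
    fin_cases i
    · obtain ⟨a, rfl⟩ : ∃ a', a = a' + 1 :=
        Nat.exists_eq_succ_of_ne_zero fun ha => by simp [ehrenfestState, ha] at hi
      exact ⟨a, b + 1, by omega, ehrenfestState_succ_add_zero γ a b⟩
    · obtain ⟨b, rfl⟩ : ∃ b', b = b' + 1 :=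
        Nat.exists_eq_succ_of_ne_zero fun hb => by simp [ehrenfestState, hb] at hi
      exact ⟨a + 1, b, by omega, ehrenfestState_succ_add_one γ a b⟩

lemma polyaTenable_ehrenfestState (hγ : 0 < γ) (hkm : 0 < k + m) :
    PolyaTenable (ehrenfestMatrix γ) (ehrenfestState γ k m) := by
  intro x hx
  obtain ⟨a, b, hab, rfl⟩ := hx.exists_eq_ehrenfestState
  refine ⟨fun hzero => ?_, fun j => ?_⟩
  · have ha : a = 0 := by simpa [ehrenfestState, hγ.ne'] using congrFun hzero 0
    have hb : b = 0 := by simpa [ehrenfestState, hγ.ne'] using congrFun hzero 1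
    omega
  · fin_cases j
    exacts [mul_nonneg hγ.le a.cast_nonneg, mul_nonneg hγ.le b.cast_nonneg]

-- Otherwise the `i`-th coordinate would be negative after `⌈x i / γ⌉` renewals of type `i`.
lemma PolyaTenable.exists_div_eq_natCast (hγ : 0 < γ) {x : Fin 2 → ℝ}
    (h : PolyaTenable (ehrenfestMatrix γ) x) (i : Fin 2) : ∃ k : ℕ, x i / γ = k := by
  have hreach : PolyaReachable (ehrenfestMatrix γ) x
      (x + ⌈x i / γ⌉₊ • ehrenfestMatrix γ i) := .add_nsmul _ fun j hj => by
    have hlt := (lt_div_iff₀ hγ).mp (Nat.lt_ceil.mp hj)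
    rw [ehrenfestMatrix_apply_self]
    linarith
  have hnonneg := (h _ hreach).2 i
  rw [Pi.add_apply, Pi.smul_apply, ehrenfestMatrix_apply_self, nsmul_eq_mul] at hnonneg
  exact ⟨_, (Nat.le_ceil _).antisymm ((le_div_iff₀ hγ).mpr (by linarith))⟩

lemma polyaTenable_ehrenfest_iff (hγ : 0 < γ) {lam x₀ y₀ : ℝ} (hlam : x₀ + y₀ = lam) :
    PolyaTenable (ehrenfestMatrix γ) ![x₀, y₀] ↔
      (∃ k : ℕ, x₀ / γ = k) ∧ (∃ m : ℕ, y₀ / γ = m) ∧ 0 < lam := by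
  refine ⟨fun h => ⟨h.exists_div_eq_natCast hγ 0, h.exists_div_eq_natCast hγ 1, ?_⟩, ?_⟩
  · simpa [hlam] using h.sum_pos .start
  · rintro ⟨⟨k, hk⟩, ⟨m, hm⟩, hpos⟩
    rw [div_eq_iff hγ.ne', mul_comm] at hk hm
    subst hk hm hlam
    rw [← mul_add] at hpos
    exact polyaTenable_ehrenfestState hγ (by exact_mod_cast pos_of_mul_pos_right hpos hγ.le)

end EhrenfestState

section EhrenfestWeight

variable {γ r : ℝ}

/-- The expected weight after time `r` of a particle which switches between two urns at rate `γ`,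
where a particle weighs `w` in the urn in which it starts and `w'` in the other one. -/
noncomputable def ehrenfestWeight (γ : ℝ) (w w' : ℂ) (r : ℝ) : ℂ :=
  ((1 + Real.exp (-2 * γ * r)) * w + (1 - Real.exp (-2 * γ * r)) * w') / 2

lemma ehrenfestWeight_zero (γ : ℝ) (w w' : ℂ) : ehrenfestWeight γ w w' 0 = w := by
  simp only [ehrenfestWeight, mul_zero, Real.exp_zero, Complex.ofReal_one]
  ring

lemma hasDerivAt_ehrenfestWeight (γ : ℝ) (w w' : ℂ) (r : ℝ) :
    HasDerivAt (ehrenfestWeight γ w w')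
      (γ * (ehrenfestWeight γ w' w r - ehrenfestWeight γ w w' r)) r := by
  have hexp := (((hasDerivAt_id r).const_mul (-2 * γ)).exp).ofReal_comp
  refine ((((hexp.const_add 1).mul_const w).add
    ((hexp.const_sub 1).mul_const w')).div_const 2).congr_deriv ?_
  simp only [ehrenfestWeight, id_eq]
  push_cast
  ring

lemma norm_ehrenfestWeight_le (hγ : 0 ≤ γ) (hr : 0 ≤ r) (w w' : ℂ) :
    ‖ehrenfestWeight γ w w' r‖ ≤ ‖w‖ + ‖w'‖ := by
  have hq₁ : Real.exp (-2 * γ * r) ≤ 1 := Real.exp_le_one_iff.mpr (by nlinarith [mul_nonneg hγ hr])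
  have hq₀ := Real.exp_pos (-2 * γ * r)
  rw [ehrenfestWeight]
  set q := Real.exp (-2 * γ * r)
  calc ‖((1 + q) * w + (1 - q) * w') / 2‖
      ≤ (‖((1 + q : ℝ) : ℂ) * w‖ + ‖((1 - q : ℝ) : ℂ) * w'‖) / 2 := by
        rw [norm_div, Complex.norm_ofNat]
        push_cast
        gcongr
        exact norm_add_le _ _
    _ = ((1 + q) * ‖w‖ + (1 - q) * ‖w'‖) / 2 := by
        rw [norm_mul, norm_mul, Complex.norm_of_nonneg (by linarith),
          Complex.norm_of_nonneg (by linarith)]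
    _ ≤ ‖w‖ + ‖w'‖ := by nlinarith [norm_nonneg w, norm_nonneg w']

lemma tendsto_ehrenfestWeight (hγ : 0 < γ) (w w' : ℂ) :
    Tendsto (fun t : ℝ≥0 => ehrenfestWeight γ w w' t) atTop (𝓝 ((w + w') / 2)) := by
  have hq : Tendsto (fun t : ℝ≥0 => (Real.exp (-2 * γ * t) : ℂ)) atTop (𝓝 ((0 : ℝ) : ℂ)) :=
    (Complex.continuous_ofReal.tendsto 0).comp (tendsto_exp_neg_two_mul hγ)
  have hlim := (((hq.const_add 1).mul_const w).add ((hq.const_sub 1).mul_const w')).div_const 2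
  simpa only [ehrenfestWeight, Complex.ofReal_zero, add_zero, sub_zero, one_mul] using hlim

/-- The expected value after time `r` of the product of the weights of all particles, for the
particles of the position `x` switching urns independently of each other. -/
noncomputable def ehrenfestWeightProd (γ : ℝ) (w w' : ℂ) (r : ℝ) (x : Fin 2 → ℝ) : ℂ :=
  ehrenfestWeight γ w w' r ^ ⌊x 0 / γ⌋₊ * ehrenfestWeight γ w' w r ^ ⌊x 1 / γ⌋₊

lemma ehrenfestWeightProd_ehrenfestState (hγ : γ ≠ 0) (w w' : ℂ) (r : ℝ) (a b : ℕ) :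
    ehrenfestWeightProd γ w w' r (ehrenfestState γ a b) =
      ehrenfestWeight γ w w' r ^ a * ehrenfestWeight γ w' w r ^ b := by
  simp [ehrenfestWeightProd, ehrenfestState, hγ]

lemma smul_ehrenfestWeightProd_sub_zero (hγ : γ ≠ 0) (w w' : ℂ) (r : ℝ) (a b : ℕ) :
    ehrenfestState γ a b 0 •
        (ehrenfestWeightProd γ w w' r (ehrenfestState γ a b + ehrenfestMatrix γ 0) -
          ehrenfestWeightProd γ w w' r (ehrenfestState γ a b)) =
      (a * ehrenfestWeight γ w w' r ^ (a - 1) *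
        (γ * (ehrenfestWeight γ w' w r - ehrenfestWeight γ w w' r))) *
          ehrenfestWeight γ w' w r ^ b := by
  rcases a with _ | a
  · simp [ehrenfestState]
  · simp only [ehrenfestState_succ_add_zero, ehrenfestWeightProd_ehrenfestState hγ]
    simp only [ehrenfestState, Matrix.cons_val_zero, Complex.real_smul, Nat.add_sub_cancel]
    push_cast
    ring

lemma smul_ehrenfestWeightProd_sub_one (hγ : γ ≠ 0) (w w' : ℂ) (r : ℝ) (a b : ℕ) :
    ehrenfestState γ a b 1 •
        (ehrenfestWeightProd γ w w' r (ehrenfestState γ a b + ehrenfestMatrix γ 1) -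
          ehrenfestWeightProd γ w w' r (ehrenfestState γ a b)) =
      ehrenfestWeight γ w w' r ^ a * (b * ehrenfestWeight γ w' w r ^ (b - 1) *
        (γ * (ehrenfestWeight γ w w' r - ehrenfestWeight γ w' w r))) := by
  rcases b with _ | b
  · simp [ehrenfestState]
  · simp only [ehrenfestState_succ_add_one, ehrenfestWeightProd_ehrenfestState hγ]
    simp only [ehrenfestState, Matrix.cons_val_one, Matrix.cons_val_fin_one, Complex.real_smul,
      Nat.add_sub_cancel]
    push_cast
    ring

lemma hasDerivAt_ehrenfestWeightProd (hγ : γ ≠ 0) (w w' : ℂ) (r : ℝ) (a b : ℕ) :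
    HasDerivAt (fun r => ehrenfestWeightProd γ w w' r (ehrenfestState γ a b))
      (∑ i, ehrenfestState γ a b i •
        (ehrenfestWeightProd γ w w' r (ehrenfestState γ a b + ehrenfestMatrix γ i) -
          ehrenfestWeightProd γ w w' r (ehrenfestState γ a b))) r := by
  rw [Fin.sum_univ_two, smul_ehrenfestWeightProd_sub_zero hγ, smul_ehrenfestWeightProd_sub_one hγ]
  simp only [ehrenfestWeightProd_ehrenfestState hγ]
  exact ((hasDerivAt_ehrenfestWeight γ w w' r).pow a).mul
    ((hasDerivAt_ehrenfestWeight γ w' w r).pow b)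

lemma isPolyaBackwardSolution_ehrenfestWeightProd (hγ : 0 < γ) (w w' : ℂ) (k m : ℕ) :
    IsPolyaBackwardSolution (ehrenfestMatrix γ) (ehrenfestState γ k m)
      (ehrenfestWeightProd γ w w') where
  stronglyMeasurable := by
    unfold Function.uncurry ehrenfestWeightProd ehrenfestWeight
    exact Measurable.stronglyMeasurable (by fun_prop)
  hasDerivAt r _ z hz := by
    obtain ⟨a, b, -, rfl⟩ := hz.exists_eq_ehrenfestState
    exact hasDerivAt_ehrenfestWeightProd hγ.ne' w w' r a b
  bounded t := by
    refine ⟨(‖w‖ + ‖w'‖) ^ (k + m), fun r hr z hz => ?_⟩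
    obtain ⟨a, b, hab, rfl⟩ := hz.exists_eq_ehrenfestState
    rw [ehrenfestWeightProd_ehrenfestState hγ.ne', norm_mul, norm_pow, norm_pow, ← hab, pow_add]
    gcongr
    · exact norm_ehrenfestWeight_le hγ.le hr.1 w w'
    · exact (norm_ehrenfestWeight_le hγ.le hr.1 w' w).trans_eq (add_comm _ _)

end EhrenfestWeight

namespace IsPolyaWalk

variable {Ω : Type*} {mΩ : MeasurableSpace Ω} {P : Measure Ω} [IsProbabilityMeasure P] {γ : ℝ}
  {k m : ℕ} {X : ℝ≥0 → Ω → Fin 2 → ℝ}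

lemma ae_exists_eq_ehrenfestState (hγ : 0 < γ) (hkm : 0 < k + m)
    (h : IsPolyaWalk (ehrenfestMatrix γ) (ehrenfestState γ k m) P X) :
    ∀ᵐ ω ∂P, ∀ t, ∃ a b : ℕ, a + b = k + m ∧ X t ω = ehrenfestState γ a b :=
  (h.ae_polyaReachable (polyaTenable_ehrenfestState hγ hkm) (sum_ehrenfestMatrix γ)).mono
    fun _ hω t => (hω t).exists_eq_ehrenfestState

lemma ae_add_eq_ehrenfest (hγ : 0 < γ) (hkm : 0 < k + m)
    (h : IsPolyaWalk (ehrenfestMatrix γ) (ehrenfestState γ k m) P X) :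
    ∀ᵐ ω ∂P, ∀ t, X t ω 0 + X t ω 1 = γ * k + γ * m :=
  (h.ae_polyaReachable (polyaTenable_ehrenfestState hγ hkm) (sum_ehrenfestMatrix γ)).mono
    fun ω hω t => by
      simpa only [Fin.sum_univ_two] using! (hω t).sum_eq (sum_ehrenfestMatrix γ)

lemma aemeasurable_ehrenfest (hγ : 0 < γ) (hkm : 0 < k + m)
    (h : IsPolyaWalk (ehrenfestMatrix γ) (ehrenfestState γ k m) P X) (t : ℝ≥0) :
    AEMeasurable (fun ω => X t ω 0) P :=
  (measurable_pi_apply 0).comp_aemeasurable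
    (h.aemeasurable (polyaTenable_ehrenfestState hγ hkm) (sum_ehrenfestMatrix γ) t)

lemma integrable_exp_mul_ehrenfest (hγ : 0 < γ) (hkm : 0 < k + m)
    (h : IsPolyaWalk (ehrenfestMatrix γ) (ehrenfestState γ k m) P X) (t : ℝ≥0) (u : ℝ) :
    Integrable (fun ω => Real.exp (u * X t ω 0)) P := by
  refine integrable_exp_mul_of_mem_Icc (a := 0) (b := γ * (k + m))
    (h.aemeasurable_ehrenfest hγ hkm t) ?_
  filter_upwards [h.ae_exists_eq_ehrenfestState hγ hkm] with ω hω
  obtain ⟨a, b, hab, hX⟩ := hω t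
  have ha : (a : ℝ) ≤ k + m := by exact_mod_cast hab ▸ Nat.le_add_right a b
  rw [hX]
  exact ⟨mul_nonneg hγ.le a.cast_nonneg, mul_le_mul_of_nonneg_left ha hγ.le⟩

lemma complexMGF_ehrenfest (hγ : 0 < γ) (hkm : 0 < k + m)
    (h : IsPolyaWalk (ehrenfestMatrix γ) (ehrenfestState γ k m) P X) (t : ℝ≥0) (v : ℂ) :
    complexMGF (fun ω => X t ω 0) P v =
      ehrenfestWeight γ (Complex.exp (γ * v)) 1 t ^ k *
        ehrenfestWeight γ 1 (Complex.exp (γ * v)) t ^ m := by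
  rw [← ehrenfestWeightProd_ehrenfestState hγ.ne', ← h.integral_eq_of_isPolyaBackwardSolution
    (polyaTenable_ehrenfestState hγ hkm) (sum_ehrenfestMatrix γ)
    (isPolyaBackwardSolution_ehrenfestWeightProd hγ _ _ k m), complexMGF]
  refine integral_congr_ae ((h.ae_exists_eq_ehrenfestState hγ hkm).mono fun ω hω => ?_)
  obtain ⟨a, b, -, hX⟩ := hω t
  simp only [hX, ehrenfestWeightProd_ehrenfestState hγ.ne', ehrenfestWeight_zero, one_pow, mul_one,
    ← Complex.exp_nat_mul]
  simp only [ehrenfestState, Matrix.cons_val_zero]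
  push_cast
  ring_nf

lemma tendsto_complexMGF_ehrenfest (hγ : 0 < γ) (hkm : 0 < k + m)
    (h : IsPolyaWalk (ehrenfestMatrix γ) (ehrenfestState γ k m) P X) (v : ℂ) :
    Tendsto (fun t : ℝ≥0 => complexMGF (fun ω => X t ω 0) P v) atTop
      (𝓝 (((1 + Complex.exp (γ * v)) / 2) ^ (k + m))) := by
  simp only [h.complexMGF_ehrenfest hγ hkm, pow_add]
  exact (add_comm 1 (Complex.exp (γ * v)) ▸ (tendsto_ehrenfestWeight hγ _ 1).pow k).mul
    ((tendsto_ehrenfestWeight hγ 1 _).pow m)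

lemma mgf_ehrenfest (hγ : 0 < γ) (hkm : 0 < k + m)
    (h : IsPolyaWalk (ehrenfestMatrix γ) (ehrenfestState γ k m) P X) (t : ℝ≥0) (u : ℝ) :
    mgf (fun ω => X t ω 0) P u =
      ((1 + Real.exp (-2 * γ * t + γ * u) + Real.exp (γ * u) - Real.exp (-2 * γ * t)) /
        (1 - Real.exp (-2 * γ * t + γ * u) + Real.exp (γ * u) + Real.exp (-2 * γ * t))) ^ k *
      ((1 - Real.exp (-2 * γ * t + γ * u) + Real.exp (γ * u) + Real.exp (-2 * γ * t)) / 2)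
        ^ (k + m) := by
  have hle : Real.exp (-2 * γ * t + γ * u) ≤ Real.exp (γ * u) := by
    have := mul_nonneg hγ.le t.coe_nonneg
    exact Real.exp_le_exp.mpr (by linarith)
  have hden : 0 < 1 - Real.exp (-2 * γ * t + γ * u) + Real.exp (γ * u) + Real.exp (-2 * γ * t) := by
    linarith [Real.exp_pos (-2 * γ * t)]
  rw [pow_add, ← mul_assoc, ← mul_pow, div_mul_div_cancel₀ hden.ne', ← Complex.ofReal_inj,
    ← complexMGF_ofReal, h.complexMGF_ehrenfest hγ hkm]
  simp only [ehrenfestWeight, Real.exp_add]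
  push_cast
  ring_nf

lemma tendsto_mgf_ehrenfest (hγ : 0 < γ) (hkm : 0 < k + m)
    (h : IsPolyaWalk (ehrenfestMatrix γ) (ehrenfestState γ k m) P X) (u : ℝ) :
    Tendsto (fun t : ℝ≥0 => mgf (fun ω => X t ω 0) P u) atTop
      (𝓝 (((1 + Real.exp (γ * u)) / 2) ^ (k + m))) := by
  rw [← tendsto_ofReal_iff]
  simpa only [complexMGF_ofReal, Complex.ofReal_pow, Complex.ofReal_div, Complex.ofReal_add,
    Complex.ofReal_one, Complex.ofReal_ofNat, Complex.ofReal_exp, Complex.ofReal_mul]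
    using h.tendsto_complexMGF_ehrenfest hγ hkm u

lemma charFun_map_div_ehrenfest (hγ : 0 < γ) (hkm : 0 < k + m)
    (h : IsPolyaWalk (ehrenfestMatrix γ) (ehrenfestState γ k m) P X) (t : ℝ≥0) (s : ℝ) :
    charFun (P.map fun ω => X t ω 0 / γ) s =
      complexMGF (fun ω => X t ω 0) P ((γ⁻¹ * s : ℝ) * Complex.I) := by
  have hm := h.aemeasurable_ehrenfest hγ hkm t
  simp only [complexMGF_mul_I hm, div_eq_inv_mul, charFun_map_mul_comp hm]

lemma tendstoInDistribution_ehrenfest (hγ : 0 < γ) (hkm : 0 < k + m)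
    (h : IsPolyaWalk (ehrenfestMatrix γ) (ehrenfestState γ k m) P X) :
    TendstoInDistribution (fun (t : ℝ≥0) ω => X t ω 0 / γ) atTop (fun n : ℕ => (n : ℝ))
      (fun _ => P) (binomial (k + m) ⟨1 / 2, by norm_num, by norm_num⟩) where
  forall_aemeasurable t := (h.aemeasurable_ehrenfest hγ hkm t).div_const γ
  tendsto := by
    refine tendsto_of_seq_tendsto fun t ht => ?_
    refine ProbabilityMeasure.tendsto_iff_tendsto_charFun.mpr fun s => ?_
    refine Tendsto.congr (fun n => (h.charFun_map_div_ehrenfest hγ hkm (t n) s).symm) ?_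
    rw [ProbabilityMeasure.coe_mk, charFun_map_cast_binomial]
    convert! (h.tendsto_complexMGF_ehrenfest hγ hkm ((γ⁻¹ * s : ℝ) * Complex.I)).comp ht using 3
    rw [← mul_assoc, ← Complex.ofReal_mul, mul_inv_cancel_left₀ hγ.ne']
    push_cast
    ring

end IsPolyaWalk

theorem mainTheorem5 (γ : ℝ) (hγ : 0 < γ) (lam x₀ y₀ : ℝ) (hlam : x₀ + y₀ = lam) :
    (PolyaTenable (ehrenfestMatrix γ) ![x₀, y₀] ↔
      (∃ k : ℕ, x₀ / γ = k) ∧ (∃ m : ℕ, y₀ / γ = m) ∧ 0 < lam) ∧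
    (PolyaTenable (ehrenfestMatrix γ) ![x₀, y₀] →
      ∃ N : ℕ, 0 < N ∧ lam / γ = N ∧
        ∀ {Ω : Type*} [MeasurableSpace Ω] (P : Measure Ω) [IsProbabilityMeasure P]
          (X : ℝ≥0 → Ω → Fin 2 → ℝ),
          IsPolyaWalk (ehrenfestMatrix γ) ![x₀, y₀] P X →
          (∀ᵐ ω ∂P, ∀ t : ℝ≥0, X t ω 0 + X t ω 1 = lam) ∧
          (∀ (t : ℝ≥0) (u : ℝ),
            Integrable (fun ω => Real.exp (u * X t ω 0)) P ∧
            mgf (fun ω => X t ω 0) P u =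
              ((1 + Real.exp (-2 * γ * t + γ * u) + Real.exp (γ * u) - Real.exp (-2 * γ * t)) /
                (1 - Real.exp (-2 * γ * t + γ * u) + Real.exp (γ * u) + Real.exp (-2 * γ * t)))
                  ^ (x₀ / γ) *
              ((1 - Real.exp (-2 * γ * t + γ * u) + Real.exp (γ * u) + Real.exp (-2 * γ * t)) / 2)
                  ^ (lam / γ)) ∧
          (∀ u : ℝ, Tendsto (fun t : ℝ≥0 => mgf (fun ω => X t ω 0) P u) atTop
            (𝓝 (((1 + Real.exp (γ * u)) / 2) ^ (lam / γ)))) ∧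
          TendstoInDistribution (fun (t : ℝ≥0) ω => X t ω 0 / γ) atTop (fun k : ℕ => (k : ℝ))
            (fun _ => P) (binomial N ⟨1 / 2, by norm_num, by norm_num⟩)) := by
  refine ⟨polyaTenable_ehrenfest_iff hγ hlam, fun hten => ?_⟩
  obtain ⟨⟨k, hk⟩, ⟨m, hm⟩, hpos⟩ := (polyaTenable_ehrenfest_iff hγ hlam).mp hten
  have hlamN : lam / γ = (k + m : ℕ) := by rw [← hlam, add_div, hk, hm, Nat.cast_add]
  have hkm : 0 < k + m := by exact_mod_cast hlamN ▸ div_pos hpos hγ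
  refine ⟨k + m, hkm, hlamN, fun {Ω} _ P _ X hX => ?_⟩
  obtain rfl : x₀ = γ * k := by rw [← hk, mul_div_cancel₀ _ hγ.ne']
  obtain rfl : y₀ = γ * m := by rw [← hm, mul_div_cancel₀ _ hγ.ne']
  change IsPolyaWalk (ehrenfestMatrix γ) (ehrenfestState γ k m) P X at hX
  simp only [hk, hlamN, Real.rpow_natCast]
  exact ⟨hlam ▸ hX.ae_add_eq_ehrenfest hγ hkm,
    fun t u => ⟨hX.integrable_exp_mul_ehrenfest hγ hkm t u, hX.mgf_ehrenfest hγ hkm t u⟩,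
    hX.tendsto_mgf_ehrenfest hγ hkm, hX.tendstoInDistribution_ehrenfest hγ hkm⟩
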